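/- For $m\in\{1,2,\dots\}$ let $S^m$ be the unit sphere of $\mathbb{R}^{m+1}$, and let $S^\infty$ be the unit sphere of the real sequence space $\ell^2$. Let $m,M\in\{1,2,\dots,\infty\}$. A real kernel $K$ on a set $X$ is positive definite if $\sum_{\mu,\nu=1}^n c_\mu c_\nu K(p_\mu,p_\nu)\ge 0$ for all $n\ge 1$, all distinct points $p_1,\dots,p_n\in X$ and all real scalars $c_1,\dots,c_n$; it is strictly positive definite if moreover these sums are positive whenever the $c_\mu$ are not all zero. A function $f:[-1,1]^2\to\mathbb{R}$ is the isotropic part of a kernel $K$ on $S^m\times S^M$ if $K((x,z),(y,w))=f(x\cdot y,z\cdot w)$ for all $x,y\in S^m$ and $z,w\in S^M$. A continuous function $g:[0,\infty)^2\to\mathbb{R}$ is completely monotonic on $(0,\infty)^2$ if it is $C^\infty$ on $(0,\infty)^2$ and $$(-1)^{n_1+n_2}\frac{\partial^{n_1+n_2}g}{\partial u^{n_1}\partial v^{n_2}}(u,v)\ge 0,\qquad u,v>0,\quad n_1,n_2\in\{0,1,2,\dots\}.$$ **Proposition.** If $g$ is completely monotonic on $(0,\infty)^2$, then $$f(t,s):=g(\arccos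 t,\arccos s),\qquad t,s\in[-1,1],$$ is the isotropic part of a continuous positive definite kernel on $S^m\times S^M$. Further, if $g$ is not of the form $g(u,v)=a(u)+b(v)$ on $[0,\infty)^2$ with functions $a,b:[0,\infty)\to\mathbb{R}$ (in particular $g$ is nonconstant), then $f$ is the isotropic part of a continuous strictly positive definite kernel on $S^m\times S^M$. -/

import Mathlib

open scoped ContDiff

/-- The ambient real Hilbert space of the sphere `S^m`, `m = 0, 1, 2, …, ∞`: the Euclidean space
`ℝ^(m+1)` for finite `m`, and the real sequence space `ℓ²` for `m = ∞`. -/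
def Ambient : ℕ∞ → Type
  | some m => EuclideanSpace ℝ (Fin (m + 1))
  | none => lp (fun _ : ℕ => ℝ) 2

noncomputable instance instNormedAddCommGroupAmbient :
    (m : ℕ∞) → NormedAddCommGroup (Ambient m)
  | some m => inferInstanceAs (NormedAddCommGroup (EuclideanSpace ℝ (Fin (m + 1))))
  | none => inferInstanceAs (NormedAddCommGroup (lp (fun _ : ℕ => ℝ) 2))

noncomputable instance instInnerProductSpaceAmbient :
    (m : ℕ∞) → InnerProductSpace ℝ (Ambient m)
  | some m => inferInstanceAs (InnerProductSpace ℝ (EuclideanSpace ℝ (Fin (m + 1))))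
  | none => inferInstanceAs (InnerProductSpace ℝ (lp (fun _ : ℕ => ℝ) 2))

/-- The unit sphere `S^m`, `m = 0, 1, 2, …, ∞`. It carries the subspace topology, which is also the
topology of the geodesic distance. -/
abbrev USphere (m : ℕ∞) : Type := Metric.sphere (0 : Ambient m) 1

/-- A real kernel `K` on `X` is positive definite if all its quadratic forms over finitely many
distinct points are nonnegative. -/
def IsPosDefKernel {X : Type} (K : X → X → ℝ) : Prop :=
  ∀ n : ℕ, 1 ≤ n → ∀ x : Fin n → X, Function.Injective x → ∀ c : Fin n → ℝ,
    0 ≤ ∑ μ, ∑ ν, c μ * c ν * K (x μ) (x ν)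

/-- `f` (only its values on `[-1,1]²` matter) is the isotropic part of the kernel `K` on
`S^m × S^M`: `K((x,z),(y,w)) = f(x·y, z·w)`. -/
def IsIsotropicPart {m M : ℕ∞} (f : ℝ → ℝ → ℝ)
    (K : USphere m × USphere M → USphere m × USphere M → ℝ) : Prop :=
  ∀ (x y : USphere m) (z w : USphere M),
    K (x, z) (y, w) = f (inner ℝ (x : Ambient m) (y : Ambient m))
      (inner ℝ (z : Ambient M) (w : Ambient M))

/-- `f` is the isotropic part of a (continuous) positive definite kernel on `S^m × S^M`. -/
def IsPartOfPosDef (m M : ℕ∞) (f : ℝ → ℝ → ℝ) : Prop :=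
  ∃ K : USphere m × USphere M → USphere m × USphere M → ℝ,
    IsIsotropicPart f K ∧ Continuous (Function.uncurry K) ∧ IsPosDefKernel K

/-- A positive definite kernel `K` on `X` is strictly positive definite of order `n` if its quadratic
forms over `n` distinct points are positive unless all the scalars vanish. -/
def IsStrictlyPosDefOfOrder {X : Type} (n : ℕ) (K : X → X → ℝ) : Prop :=
  IsPosDefKernel K ∧ ∀ x : Fin n → X, Function.Injective x → ∀ c : Fin n → ℝ, c ≠ 0 →
    0 < ∑ μ, ∑ ν, c μ * c ν * K (x μ) (x ν)

/-- `f` is the isotropic part of a (continuous) kernel on `S^m × S^M` that is strictly positive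
definite, that is, strictly positive definite of every order. -/
def IsPartOfStrictlyPosDef (m M : ℕ∞) (f : ℝ → ℝ → ℝ) : Prop :=
  ∃ K : USphere m × USphere M → USphere m × USphere M → ℝ,
    IsIsotropicPart f K ∧ Continuous (Function.uncurry K) ∧
      ∀ n : ℕ, 1 ≤ n → IsStrictlyPosDefOfOrder n K

/-- The partial derivative `∂^(i+j) g / ∂u^i ∂v^j` at `(u, v)`. -/
noncomputable def mixedPartial (i j : ℕ) (g : ℝ × ℝ → ℝ) (u v : ℝ) : ℝ :=
  iteratedDeriv i (fun u' => iteratedDeriv j (fun v' => g (u', v')) v) u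

/-- A function `g` on `[0,∞)²` (its values elsewhere are irrelevant) is completely monotonic on
`(0,∞)²` if it is continuous on `[0,∞)²`, smooth on `(0,∞)²`, and
`(-1)^(i+j) ∂^(i+j) g / ∂u^i ∂v^j ≥ 0` on `(0,∞)²` for all `i, j ≥ 0`. -/
structure IsCompletelyMonotonic (g : ℝ × ℝ → ℝ) : Prop where
  continuousOn : ContinuousOn g (Set.Ici 0 ×ˢ Set.Ici 0)
  contDiffOn : ContDiffOn ℝ ∞ g (Set.Ioi 0 ×ˢ Set.Ioi 0)
  sign : ∀ (i j : ℕ) (u v : ℝ), 0 < u → 0 < v → 0 ≤ (-1) ^ (i + j) * mixedPartial i j g u v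

/-!
Since `∂/∂r arcsin (r t) = t / √(1 - (r t)²)` preserves positive semidefiniteness entrywise for
`0 < r < 1`, so does `arcsin`, hence `π - arccos ⟪x, y⟫ = π / 2 + arcsin ⟪x, y⟫` is a positive
definite kernel on every unit sphere, with values in `[0, π]`. By Bernstein's theorem on absolutely
monotone functions `g (π - x, π - y)` is a double power series with nonnegative coefficients, and
the Schur product theorem gives the positive definiteness of `g (arccos ⟪x, y⟫, arccos ⟪z, w⟫)`.

If one mixed derivative of order `(i + 1, j + 1)` vanishes at one point, then `g` is additively
separable. Otherwise each coefficient of `x ^ (k + 1) * y ^ (k + 1)` is positive, so the kernel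
matrix of distinct points dominates, for every `k`, a positive multiple of the entrywise power of
exponent `k + 1` of a matrix with diagonal `1` and other entries in `[0, 1)`. These powers tend to
the identity, so one of them is positive on any given nonzero vector.
-/

open Finset Filter Topology

section Bernstein

variable {f : ℝ → ℝ} {s : Set ℝ} {x y : ℝ}

theorem iteratedDeriv_nonneg_of_absolutelyMonotoneOn (hf : AbsolutelyMonotoneOn f s)
    (hs : IsOpen s) (k : ℕ) (hx : x ∈ s) : 0 ≤ iteratedDeriv k f x := by
  rw [← iteratedDerivWithin_of_isOpen hs hx]
  exact hf.iteratedDerivWithin_nonneg hs.uniqueDiffOn k hx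

theorem absolutelyMonotoneOn_of_iteratedDeriv_nonneg (hs : IsOpen s) (hf : ContDiffOn ℝ ∞ f s)
    (h0 : ∀ k, ∀ x ∈ s, 0 ≤ iteratedDeriv k f x) : AbsolutelyMonotoneOn f s :=
  (AbsolutelyMonotoneOn.iff_iteratedDerivWithin_nonneg hs.uniqueDiffOn).2
    ⟨hf, fun k x hx => by rw [iteratedDerivWithin_of_isOpen hs hx]; exact h0 k x hx⟩

theorem taylorWithinEval_uIcc_eq_sum (hxy : x < y) (hf : ContDiffOn ℝ ∞ f s) (hs : IsOpen s)
    (hx : x ∈ s) (n : ℕ) :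
    taylorWithinEval f n (Set.uIcc x y) x y =
      ∑ k ∈ range (n + 1), iteratedDeriv k f x / k.factorial * (y - x) ^ k := by
  rw [taylor_within_apply]
  refine sum_congr rfl fun k _ => ?_
  rw [iteratedDerivWithin_eq_iteratedDeriv (uniqueDiffOn_uIcc hxy.ne)
    ((hf.contDiffAt (hs.mem_nhds hx)).of_le (mod_cast le_top)) Set.left_mem_uIcc, smul_eq_mul]
  ring

theorem taylorSum_le_of_absolutelyMonotoneOn (hf : AbsolutelyMonotoneOn f s) (hs : IsOpen s)
    [s.OrdConnected] (hx : x ∈ s) (hy : y ∈ s) (hxy : x < y) (n : ℕ) :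
    ∑ k ∈ range (n + 1), iteratedDeriv k f x / k.factorial * (y - x) ^ k ≤ f y := by
  have hsub : Set.uIcc x y ⊆ s := Set.OrdConnected.uIcc_subset ‹_› hx hy
  obtain ⟨t, ht, hrem⟩ := taylor_mean_remainder_lagrange_iteratedDeriv (n := n) hxy.ne
    ((hf.contDiffOn.of_le (mod_cast le_top)).mono hsub)
  rw [taylorWithinEval_uIcc_eq_sum hxy hf.contDiffOn hs hx] at hrem
  have ht0 := iteratedDeriv_nonneg_of_absolutelyMonotoneOn hf hs (n + 1)
    (hsub (Set.uIoo_subset_uIcc_self ht))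
  have : 0 ≤ iteratedDeriv (n + 1) f t * (y - x) ^ (n + 1) / (n + 1).factorial := by
    have := sub_pos.2 hxy
    positivity
  linarith

theorem iteratedDeriv_mul_pow_le_of_absolutelyMonotoneOn (hf : AbsolutelyMonotoneOn f s)
    (hs : IsOpen s) [s.OrdConnected] (hx : x ∈ s) (hy : y ∈ s) (hxy : x < y) (k : ℕ) :
    iteratedDeriv k f x / k.factorial * (y - x) ^ k ≤ f y := by
  refine le_trans ?_ (taylorSum_le_of_absolutelyMonotoneOn hf hs hx hy hxy k)
  refine single_le_sum (f := fun k => iteratedDeriv k f x / k.factorial * (y - x) ^ k)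
    (fun j _ => ?_) (self_mem_range_succ k)
  have := iteratedDeriv_nonneg_of_absolutelyMonotoneOn hf hs j hx
  have := sub_pos.2 hxy
  positivity

theorem exists_cauchy_taylorRemainder (hf : ContDiffOn ℝ ∞ f s) (hs : IsOpen s)
    [s.OrdConnected] (hx : x ∈ s) (hy : y ∈ s) (hxy : x < y) (n : ℕ) :
    ∃ t ∈ Set.Ioo x y,
      f y - ∑ k ∈ range (n + 1), iteratedDeriv k f x / k.factorial * (y - x) ^ k =
        iteratedDeriv (n + 1) f t * (y - t) ^ n / n.factorial * (y - x) := by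
  have hsub : Set.uIcc x y ⊆ s := Set.OrdConnected.uIcc_subset ‹_› hx hy
  have hcont : ∀ m : ℕ, ContDiffOn ℝ m f (Set.uIcc x y) := fun m =>
    (hf.of_le (mod_cast le_top)).mono hsub
  obtain ⟨t, ht, hrem⟩ := taylor_mean_remainder_cauchy (n := n) hxy.ne (hcont n)
    (((hcont (n + 1)).differentiableOn_iteratedDerivWithin (mod_cast n.lt_succ_self)
      (uniqueDiffOn_uIcc hxy.ne)).mono Set.uIoo_subset_uIcc_self)
  have hts := Set.uIoo_subset_uIcc_self ht
  rw [taylorWithinEval_uIcc_eq_sum hxy hf hs hx, iteratedDerivWithin_eq_iteratedDeriv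
    (uniqueDiffOn_uIcc hxy.ne) ((hf.contDiffAt (hs.mem_nhds (hsub hts))).of_le
    (mod_cast le_top)) hts] at hrem
  exact ⟨t, Set.uIoo_of_le hxy.le ▸ ht, hrem⟩

-- The derivative of order `n + 1` in Cauchy's remainder at `t` is bounded by one term of the Taylor
-- expansion of `f z` around `t`; going past `y` to `z` is what gains the geometric factor.
theorem sub_taylorSum_le_of_absolutelyMonotoneOn (hf : AbsolutelyMonotoneOn f s) (hs : IsOpen s)
    [s.OrdConnected] {z : ℝ} (hx : x ∈ s) (hz : z ∈ s) (hxy : x < y) (hyz : y < z) (n : ℕ) :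
    f y - ∑ k ∈ range (n + 1), iteratedDeriv k f x / k.factorial * (y - x) ^ k ≤
      (n + 1) * ((y - x) / (z - x)) ^ n * (f z * ((y - x) / (z - y))) := by
  have hy : y ∈ s := Set.OrdConnected.out ‹_› hx hz ⟨hxy.le, hyz.le⟩
  obtain ⟨t, ⟨hxt, hty⟩, hrem⟩ := exists_cauchy_taylorRemainder hf.contDiffOn hs hx hy hxy n
  have hts : t ∈ s := Set.OrdConnected.out ‹_› hx hy ⟨hxt.le, hty.le⟩
  have hxy' := sub_pos.2 hxy
  have : 0 < z - y := sub_pos.2 hyz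
  have : 0 < y - t := sub_pos.2 hty
  have htz' := sub_pos.2 (hty.trans hyz)
  have hxz' := sub_pos.2 (hxy.trans hyz)
  have ht0 := iteratedDeriv_nonneg_of_absolutelyMonotoneOn hf hs (n + 1) hts
  have hfz : 0 ≤ f z := iteratedDeriv_nonneg_of_absolutelyMonotoneOn hf hs 0 hz
  have hcauchy := iteratedDeriv_mul_pow_le_of_absolutelyMonotoneOn hf hs hts hz
    (hty.trans hyz) (n + 1)
  have hratio : (y - t) / (z - t) ≤ (y - x) / (z - x) := by
    rw [div_le_div_iff₀ htz' hxz']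
    nlinarith
  calc f y - ∑ k ∈ range (n + 1), iteratedDeriv k f x / k.factorial * (y - x) ^ k
      = (n + 1) * ((y - t) / (z - t)) ^ n *
          (iteratedDeriv (n + 1) f t / (n + 1).factorial * (z - t) ^ (n + 1) *
            ((y - x) / (z - t))) := by
        rw [hrem, Nat.factorial_succ, div_pow]
        push_cast
        field_simp
        ring
    _ ≤ (n + 1) * ((y - x) / (z - x)) ^ n * (f z * ((y - x) / (z - y))) := by
        gcongr

theorem hasSum_taylor_of_absolutelyMonotoneOn (hf : AbsolutelyMonotoneOn f s) (hs : IsOpen s)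
    [s.OrdConnected] (hx : x ∈ s) (hy : y ∈ s) (hxy : x ≤ y) :
    HasSum (fun k => iteratedDeriv k f x / k.factorial * (y - x) ^ k) (f y) := by
  rcases hxy.eq_or_lt with rfl | hxy
  · simpa using hasSum_single (f := fun k => iteratedDeriv k f x / k.factorial * (x - x) ^ k) 0
      fun k hk => by simp [hk]
  have hxy' := sub_pos.2 hxy
  rw [hasSum_iff_tendsto_nat_of_nonneg fun k => by
    have := iteratedDeriv_nonneg_of_absolutelyMonotoneOn hf hs k hx
    positivity]
  obtain ⟨z, hz, hyz : y < z⟩ := ((eventually_nhdsWithin_of_eventually_nhds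
    (hs.eventually_mem hy)).and (self_mem_nhdsWithin (s := Set.Ioi y))).exists
  set q := (y - x) / (z - x) with hq
  have hq0 : 0 ≤ q := by rw [hq]; exact div_nonneg hxy'.le (by linarith)
  have hq1 : q < 1 := by rw [hq, div_lt_one] <;> linarith
  have hbound : Tendsto (fun n : ℕ => ((n : ℝ) + 1) * q ^ n * (f z * ((y - x) / (z - y))))
      atTop (𝓝 0) := by
    have hlinear := tendsto_self_mul_const_pow_of_lt_one hq0 hq1
    have hgeom := tendsto_pow_atTop_nhds_zero_of_lt_one hq0 hq1
    simpa [add_mul] using (hlinear.add hgeom).mul_const (f z * ((y - x) / (z - y)))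
  have hrem : Tendsto (fun n => f y -
      ∑ k ∈ range (n + 1), iteratedDeriv k f x / k.factorial * (y - x) ^ k) atTop (𝓝 0) :=
    squeeze_zero
      (fun n => sub_nonneg.2 (taylorSum_le_of_absolutelyMonotoneOn hf hs hx hy hxy n))
      (sub_taylorSum_le_of_absolutelyMonotoneOn hf hs hx hz hxy hyz) hbound
  rw [← tendsto_add_atTop_iff_nat 1]
  simpa using hrem.const_sub (f y)

end Bernstein

/-- Complete monotonicity of a function of one variable on the open half-line `(0, ∞)`; the values
elsewhere are irrelevant. -/
structure IsCompletelyMonotonicOnIoi (h : ℝ → ℝ) : Prop where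
  contDiffOn : ContDiffOn ℝ ∞ h (Set.Ioi 0)
  sign : ∀ (k : ℕ) (u : ℝ), 0 < u → 0 ≤ (-1) ^ k * iteratedDeriv k h u

namespace IsCompletelyMonotonicOnIoi

variable {h : ℝ → ℝ} {c d u v x : ℝ} {k : ℕ}

theorem deriv_nonpos (hh : IsCompletelyMonotonicOnIoi h) (hu : 0 < u) : deriv h u ≤ 0 := by
  simpa using hh.sign 1 u hu

theorem differentiableOn (hh : IsCompletelyMonotonicOnIoi h) :
    DifferentiableOn ℝ h (Set.Ioi 0) :=
  hh.contDiffOn.differentiableOn (by simp)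

theorem antitoneOn (hh : IsCompletelyMonotonicOnIoi h) : AntitoneOn h (Set.Ioi 0) :=
  antitoneOn_of_deriv_nonpos (convex_Ioi 0) hh.differentiableOn.continuousOn
    (hh.differentiableOn.mono interior_subset)
    (fun _ hu => hh.deriv_nonpos (interior_subset hu))

theorem neg_deriv (hh : IsCompletelyMonotonicOnIoi h) :
    IsCompletelyMonotonicOnIoi fun u => -deriv h u where
  contDiffOn := (hh.contDiffOn.deriv_of_isOpen isOpen_Ioi (by simp)).neg
  sign k u hu := by
    have := hh.sign (k + 1) u hu
    rw [iteratedDeriv_fun_neg, ← iteratedDeriv_succ']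
    rwa [pow_succ, mul_neg_one, neg_mul, ← mul_neg] at this

theorem absolutelyMonotoneOn_const_sub (hh : IsCompletelyMonotonicOnIoi h) (d : ℝ) :
    AbsolutelyMonotoneOn (fun x => h (d - x)) (Set.Iio d) := by
  refine absolutelyMonotoneOn_of_iteratedDeriv_nonneg isOpen_Iio
    (hh.contDiffOn.comp (by fun_prop) fun x hx => Set.mem_Ioi.2 (sub_pos.2 hx))
      fun k x hx => ?_
  rw [iteratedDeriv_comp_const_sub]
  exact hh.sign k (d - x) (sub_pos.2 hx)

theorem hasSum (hh : IsCompletelyMonotonicOnIoi h) (hx : 0 ≤ x) (hxd : x < d) :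
    HasSum (fun k => (-1) ^ k * iteratedDeriv k h d / k.factorial * x ^ k) (h (d - x)) := by
  simpa [iteratedDeriv_comp_const_sub] using
    hasSum_taylor_of_absolutelyMonotoneOn (hh.absolutelyMonotoneOn_const_sub d) isOpen_Iio
      (Set.mem_Iio.2 (hx.trans_lt hxd)) (Set.mem_Iio.2 hxd) hx

theorem neg_deriv_mul_le (hh : IsCompletelyMonotonicOnIoi h) (hx : 0 < x) (hxd : x < d) :
    -deriv h d * x ≤ h (d - x) := by
  simpa [deriv_comp_const_sub] using iteratedDeriv_mul_pow_le_of_absolutelyMonotoneOn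
    (hh.absolutelyMonotoneOn_const_sub d) isOpen_Iio
    (Set.mem_Iio.2 (hx.trans hxd)) (Set.mem_Iio.2 hxd) hx 1

theorem tendsto_deriv_atTop (hh : IsCompletelyMonotonicOnIoi h) :
    Tendsto (deriv h) atTop (𝓝 0) := by
  have hlower : ∀ᶠ d in atTop, -(h 1 * (d - 1)⁻¹) ≤ deriv h d := by
    filter_upwards [eventually_gt_atTop 1] with d hd
    have hd' : 0 < d - 1 := sub_pos.2 hd
    have := hh.neg_deriv_mul_le hd' (by linarith)
    rw [sub_sub_cancel] at this
    rwa [neg_le, ← div_eq_mul_inv, le_div_iff₀ hd']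
  have hlim : Tendsto (fun d : ℝ => -(h 1 * (d - 1)⁻¹)) atTop (𝓝 0) := by
    have := (tendsto_inv_atTop_zero.comp
      (tendsto_atTop_add_const_right atTop (-1 : ℝ) tendsto_id)).const_mul (h 1)
    simpa [Function.comp_def, sub_eq_add_neg] using this.neg
  exact tendsto_of_tendsto_of_tendsto_of_le_of_le' hlim tendsto_const_nhds hlower
    ((eventually_gt_atTop 0).mono fun d hd => hh.deriv_nonpos hd)

theorem eq_of_eqOn_Ici (hh : IsCompletelyMonotonicOnIoi h)
    (hconst : ∀ u, c ≤ u → h u = h c) (hu : 0 < u) : h u = h c := by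
  rcases le_total c u with hcu | huc
  · exact hconst u hcu
  have hlocal : h =ᶠ[𝓝 (c + 1)] fun _ => h c :=
    (eventually_gt_nhds (lt_add_one c)).mono fun v hv => hconst v hv.le
  have htaylor := hh.hasSum (x := c + 1 - u) (d := c + 1) (by linarith) (by linarith)
  simp only [hlocal.iteratedDeriv_eq, iteratedDeriv_const, sub_sub_cancel] at htaylor
  refine htaylor.unique ?_
  simpa using hasSum_single (f := fun k : ℕ =>
    (-1) ^ k * (if k = 0 then h c else 0) / k.factorial * (c + 1 - u) ^ k) 0
    fun k hk => by simp [hk]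

theorem eq_of_deriv_eq_zero (hh : IsCompletelyMonotonicOnIoi h) (hc : 0 < c)
    (h0 : deriv h c = 0) (hu : 0 < u) : h u = h c := by
  refine hh.eq_of_eqOn_Ici (fun v hcv => ?_) hu
  have hpos : Set.Ici c ⊆ Set.Ioi 0 := fun w hw => hc.trans_le hw
  have hmono : MonotoneOn h (Set.Ici c) :=
    monotoneOn_of_deriv_nonneg (convex_Ici c) (hh.differentiableOn.continuousOn.mono hpos)
      (hh.differentiableOn.mono (interior_subset.trans hpos)) fun w hw => by
        simpa [h0] using hh.neg_deriv.antitoneOn hc (hpos (interior_subset hw)) (interior_subset hw)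
  exact le_antisymm (hh.antitoneOn hc (hpos hcv) hcv) (hmono Set.self_mem_Ici hcv hcv)

-- By induction `-h'` is constant; its limit at infinity is `0`, so it vanishes.
theorem eq_of_iteratedDeriv_succ_eq_zero (hh : IsCompletelyMonotonicOnIoi h) (hc : 0 < c)
    (h0 : iteratedDeriv (k + 1) h c = 0) (hu : 0 < u) (hv : 0 < v) : h u = h v := by
  induction k generalizing h u v with
  | zero =>
    have hderiv : deriv h c = 0 := by simpa using h0
    rw [hh.eq_of_deriv_eq_zero hc hderiv hu, hh.eq_of_deriv_eq_zero hc hderiv hv]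
  | succ k ih =>
    have hconst : ∀ w, 0 < w → deriv h w = deriv h c := fun w hw =>
      neg_injective (ih (h := fun w => -deriv h w) hh.neg_deriv (by
        rw [iteratedDeriv_fun_neg, ← iteratedDeriv_succ', h0, neg_zero]) hw hc)
    have hderiv : deriv h c = 0 := tendsto_nhds_unique
      (tendsto_const_nhds.congr' ((eventually_gt_atTop 0).mono fun w hw => (hconst w hw).symm))
      hh.tendsto_deriv_atTop
    rw [hh.eq_of_deriv_eq_zero hc hderiv hu, hh.eq_of_deriv_eq_zero hc hderiv hv]

end IsCompletelyMonotonicOnIoi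

theorem contDiffOn_iteratedDeriv_prodMk_left {g : ℝ × ℝ → ℝ} {s : Set (ℝ × ℝ)}
    (hg : ContDiffOn ℝ ∞ g s) (hs : IsOpen s) (j : ℕ) :
    ContDiffOn ℝ ∞ (fun q : ℝ × ℝ => iteratedDeriv j (fun v => g (q.1, v)) q.2) s := by
  induction j with
  | zero => simpa using hg
  | succ j ih =>
    have hfderiv : ContDiffOn ℝ ∞ (fun q => fderiv ℝ
        (fun q : ℝ × ℝ => iteratedDeriv j (fun v => g (q.1, v)) q.2) q (0, 1)) s :=
      (ih.fderiv_of_isOpen hs (by simp)).clm_apply contDiffOn_const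
    refine hfderiv.congr fun q hq => ?_
    have hpath : HasDerivAt (fun v : ℝ => (q.1, v)) ((0 : ℝ), (1 : ℝ)) q.2 :=
      (hasDerivAt_const q.2 q.1).prodMk (hasDerivAt_id q.2)
    rw [iteratedDeriv_succ]
    exact (((ih.differentiableOn (by simp)).differentiableAt
      (hs.mem_nhds hq)).hasFDerivAt.comp_hasDerivAt q.2 hpath).deriv

theorem hasSum_prod_of_nonneg {α β : Type*} {f : α × β → ℝ} {s : α → ℝ} {t : ℝ}
    (hf : ∀ p, 0 ≤ f p) (hs : ∀ a, HasSum (fun b => f (a, b)) (s a)) (ht : HasSum s t) :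
    HasSum f t := by
  have hsum : Summable f := (summable_prod_of_nonneg hf).2
    ⟨fun a => (hs a).summable, by simpa only [(hs _).tsum_eq] using ht.summable⟩
  rw [← (hsum.hasSum.prod_fiberwise hs).unique ht]
  exact hsum.hasSum

/-- The coefficient of `x ^ p.1 * y ^ p.2` in the Taylor expansion of `g (d - x, e - y)` at the
origin. -/
noncomputable def reflectedTaylorCoeff (g : ℝ × ℝ → ℝ) (d e : ℝ) (p : ℕ × ℕ) : ℝ :=
  (-1) ^ (p.1 + p.2) * mixedPartial p.1 p.2 g d e / (p.1.factorial * p.2.factorial)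

namespace IsCompletelyMonotonic

variable {g : ℝ × ℝ → ℝ} {d e u v x y : ℝ}

theorem section_fst (hg : IsCompletelyMonotonic g) (j : ℕ) (hv : 0 < v) :
    IsCompletelyMonotonicOnIoi fun u => (-1) ^ j * iteratedDeriv j (fun v => g (u, v)) v where
  contDiffOn := contDiffOn_const.mul
    ((contDiffOn_iteratedDeriv_prodMk_left hg.contDiffOn (isOpen_Ioi.prod isOpen_Ioi) j).comp
      (f := fun u : ℝ => (u, v)) (by fun_prop) fun _ hu => ⟨hu, hv⟩)
  sign i u hu := by
    rw [iteratedDeriv_const_mul_field, ← mul_assoc, ← pow_add]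
    exact hg.sign i j u v hu hv

theorem section_snd (hg : IsCompletelyMonotonic g) (hu : 0 < u) :
    IsCompletelyMonotonicOnIoi fun v => g (u, v) where
  contDiffOn := hg.contDiffOn.comp (f := fun v : ℝ => (u, v)) (by fun_prop) fun _ hv => ⟨hu, hv⟩
  sign j v hv := by simpa [mixedPartial] using hg.sign 0 j u v hu hv

theorem iteratedDeriv_section_sub (hg : IsCompletelyMonotonic g) (j : ℕ) (hu : 0 < u)
    (hx : 0 < x) (hv : 0 < v) :
    iteratedDeriv j (fun v => g (u, v) - g (x, v)) v =
      iteratedDeriv j (fun v => g (u, v)) v - iteratedDeriv j (fun v => g (x, v)) v := by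
  have hsmooth : ∀ w, 0 < w → ContDiffAt ℝ j (fun v => g (w, v)) v := fun w hw =>
    ((hg.section_snd hw).contDiffOn.contDiffAt (isOpen_Ioi.mem_nhds hv)).of_le (mod_cast le_top)
  exact iteratedDeriv_fun_sub (hsmooth u hu) (hsmooth x hx)

theorem section_sub (hg : IsCompletelyMonotonic g) (hu : 0 < u) (hux : u ≤ x) :
    IsCompletelyMonotonicOnIoi fun v => g (u, v) - g (x, v) where
  contDiffOn := (hg.section_snd hu).contDiffOn.sub (hg.section_snd (hu.trans_le hux)).contDiffOn
  sign j v hv := by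
    rw [hg.iteratedDeriv_section_sub j hu (hu.trans_le hux) hv, mul_sub, sub_nonneg]
    exact (hg.section_fst j hv).antitoneOn hu (hu.trans_le hux) hux

theorem sub_eq_sub_of_mixedPartial_eq_zero (hg : IsCompletelyMonotonic g) {i j : ℕ} (hd : 0 < d)
    (he : 0 < e) (h0 : mixedPartial (i + 1) (j + 1) g d e = 0) (hu : 0 < u) (hx : 0 < x)
    (hv : 0 < v) (hy : 0 < y) : g (u, v) - g (x, v) = g (u, y) - g (x, y) := by
  wlog hux : u ≤ x generalizing u x
  · have := this hx hu (le_of_not_ge hux)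
    linarith
  have hconst := (hg.section_fst (j + 1) he).eq_of_iteratedDeriv_succ_eq_zero (k := i) hd
    (by rw [iteratedDeriv_const_mul_field]; exact mul_eq_zero_of_right _ h0) hu hx
  refine (hg.section_sub hu hux).eq_of_iteratedDeriv_succ_eq_zero (k := j) he ?_ hv hy
  rw [hg.iteratedDeriv_section_sub (j + 1) hu hx he, sub_eq_zero]
  exact mul_left_cancel₀ (pow_ne_zero _ (by simp)) hconst

theorem exists_eq_add_of_mixedPartial_eq_zero (hg : IsCompletelyMonotonic g) {i j : ℕ}
    (hd : 0 < d) (he : 0 < e) (h0 : mixedPartial (i + 1) (j + 1) g d e = 0) :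
    ∃ a b : ℝ → ℝ, ∀ u v : ℝ, 0 ≤ u → 0 ≤ v → g (u, v) = a u + b v := by
  refine ⟨fun u => g (u, 1), fun v => g (1, v) - g (1, 1), fun u v hu hv => ?_⟩
  have hinterior : Set.EqOn g (fun p => g (p.1, 1) + (g (1, p.2) - g (1, 1)))
      (Set.Ioi 0 ×ˢ Set.Ioi 0) := fun p hp => by
    have := hg.sub_eq_sub_of_mixedPartial_eq_zero hd he h0 hp.1 one_pos hp.2 one_pos
    dsimp only
    linarith
  have hcont : ContinuousOn (fun p : ℝ × ℝ => g (p.1, 1) + (g (1, p.2) - g (1, 1)))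
      (Set.Ici 0 ×ˢ Set.Ici 0) :=
    (hg.continuousOn.comp (by fun_prop) fun p hp => ⟨hp.1, Set.mem_Ici.2 zero_le_one⟩).add
      ((hg.continuousOn.comp (by fun_prop) fun p hp => ⟨Set.mem_Ici.2 zero_le_one, hp.2⟩).sub
        continuousOn_const)
  exact hinterior.of_subset_closure hg.continuousOn hcont
    (Set.prod_mono Set.Ioi_subset_Ici_self Set.Ioi_subset_Ici_self)
    (by rw [closure_prod_eq, closure_Ioi]) ⟨hu, hv⟩

theorem reflectedTaylorCoeff_nonneg (hg : IsCompletelyMonotonic g) (hd : 0 < d) (he : 0 < e)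
    (p : ℕ × ℕ) : 0 ≤ reflectedTaylorCoeff g d e p :=
  div_nonneg (hg.sign _ _ _ _ hd he) (by positivity)

theorem reflectedTaylorCoeff_pos (hg : IsCompletelyMonotonic g)
    (hadd : ¬ ∃ a b : ℝ → ℝ, ∀ u v : ℝ, 0 ≤ u → 0 ≤ v → g (u, v) = a u + b v)
    (hd : 0 < d) (he : 0 < e) (i j : ℕ) : 0 < reflectedTaylorCoeff g d e (i + 1, j + 1) := by
  refine div_pos ((hg.sign _ _ d e hd he).lt_of_ne' fun h0 => hadd ?_) (by positivity)
  exact hg.exists_eq_add_of_mixedPartial_eq_zero hd he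
    ((mul_eq_zero.1 h0).resolve_left (pow_ne_zero _ (by simp)))

theorem hasSum_reflectedTaylorCoeff (hg : IsCompletelyMonotonic g) (hx : 0 ≤ x) (hxd : x < d)
    (hy : 0 ≤ y) (hye : y < e) :
    HasSum (fun p => reflectedTaylorCoeff g d e p * (x ^ p.1 * y ^ p.2)) (g (d - x, e - y)) := by
  have hd := hx.trans_lt hxd
  have he := hy.trans_lt hye
  rw [← (Equiv.prodComm ℕ ℕ).hasSum_iff]
  refine hasSum_prod_of_nonneg (fun p => mul_nonneg (hg.reflectedTaylorCoeff_nonneg hd he _)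
    (by positivity)) (fun j => ?_) ((hg.section_snd (sub_pos.2 hxd)).hasSum hy hye)
  have hterm : ∀ i, reflectedTaylorCoeff g d e (i, j) * (x ^ i * y ^ j) = (-1) ^ i *
      iteratedDeriv i (fun u => (-1) ^ j * iteratedDeriv j (fun v => g (u, v)) e) d /
        i.factorial * x ^ i / j.factorial * y ^ j := fun i => by
    rw [reflectedTaylorCoeff, mixedPartial, iteratedDeriv_const_mul_field, pow_add]
    field_simp
  refine (funext hterm : (fun i => reflectedTaylorCoeff g d e (i, j) * (x ^ i * y ^ j)) = _) ▸ ?_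
  exact (((hg.section_fst j he).hasSum hx hxd).div_const _).mul_right (y ^ j)

end IsCompletelyMonotonic

section LoewnerOrder

open Matrix MatrixOrder ComplexOrder

variable {ι κ 𝕜 : Type*} [RCLike 𝕜]

theorem isClosed_setOf_posSemidef : IsClosed {A : Matrix ι ι 𝕜 | A.PosSemidef} := by
  simp only [PosSemidef, Set.ofPred_and, Set.ofPred_forall, Finsupp.sum]
  exact (isClosed_eq (by fun_prop) continuous_id).inter
    (isClosed_iInter fun c => isClosed_le continuous_const (by fun_prop))

instance orderClosedTopology_loewner : OrderClosedTopology (Matrix ι ι 𝕜) where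
  isClosed_le' := isClosed_setOf_posSemidef.preimage (continuous_snd.sub continuous_fst)

theorem tendsto_matrix_iff {α R : Type*} [TopologicalSpace R] {l : Filter α}
    {F : α → Matrix ι κ R} {A : Matrix ι κ R} :
    Tendsto F l (𝓝 A) ↔ ∀ i j, Tendsto (fun a => F a i j) l (𝓝 (A i j)) :=
  tendsto_pi_nhds.trans (forall_congr' fun _ => tendsto_pi_nhds)

theorem hasSum_matrix_iff {α R : Type*} [AddCommMonoid R] [TopologicalSpace R]
    {F : α → Matrix ι κ R} {A : Matrix ι κ R} :
    HasSum F A ↔ ∀ i j, HasSum (fun a => F a i j) (A i j) :=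
  Pi.hasSum.trans (forall_congr' fun _ => Pi.hasSum)

theorem posDef_of_tendsto_of_smul_le [Finite ι] {α : Type*} {l : Filter α} [l.NeBot]
    {F : α → Matrix ι ι ℝ} {P K : Matrix ι ι ℝ} (hP : P.PosDef) (hF : Tendsto F l (𝓝 P))
    (hK : K.IsHermitian) (hle : ∀ a, ∃ c : ℝ, 0 < c ∧ c • F a ≤ K) : K.PosDef := by
  cases nonempty_fintype ι
  refine .of_dotProduct_mulVec_pos hK fun w hw => ?_
  have hlim : Tendsto (fun a => star w ⬝ᵥ F a *ᵥ w) l (𝓝 (star w ⬝ᵥ P *ᵥ w)) :=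
    ((by fun_prop : Continuous fun A : Matrix ι ι ℝ => star w ⬝ᵥ A *ᵥ w).tendsto P).comp hF
  obtain ⟨a, ha⟩ := (hlim.eventually_const_lt (hP.dotProduct_mulVec_pos hw)).exists
  obtain ⟨c, hc, hle⟩ := hle a
  have hdiff := (posSemidef_iff_dotProduct_mulVec.1 hle).2 w
  rw [sub_mulVec, dotProduct_sub, smul_mulVec, dotProduct_smul, smul_eq_mul] at hdiff
  linarith [mul_pos hc ha]

theorem le_of_hasDerivAt_posSemidef [Finite ι] {F F' : ℝ → Matrix ι ι ℝ} {a b : ℝ} (hab : a ≤ b)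
    (ha : (F a).IsHermitian) (hb : (F b).IsHermitian)
    (hcont : ContinuousOn F (Set.Icc a b))
    (hderiv : ∀ r ∈ Set.Ioo a b, ∀ i j, HasDerivAt (fun r => F r i j) (F' r i j) r)
    (hpos : ∀ r ∈ Set.Ioo a b, (F' r).PosSemidef) : F a ≤ F b := by
  cases nonempty_fintype ι
  refine le_iff.2 (posSemidef_iff_dotProduct_mulVec.2 ⟨hb.sub ha, fun w => ?_⟩)
  rw [sub_mulVec, dotProduct_sub, sub_nonneg]
  have hmono : MonotoneOn (fun r => star w ⬝ᵥ F r *ᵥ w) (Set.Icc a b) := by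
    refine monotoneOn_of_hasDerivWithinAt_nonneg (f' := fun r => star w ⬝ᵥ F' r *ᵥ w)
      (convex_Icc a b) ?_ (fun r hr => ?_) (fun r hr => ?_)
    · exact (by fun_prop : Continuous fun A : Matrix ι ι ℝ => star w ⬝ᵥ A *ᵥ w).comp_continuousOn
        hcont
    all_goals rw [interior_Icc] at hr
    · exact (HasDerivAt.fun_sum fun i _ => (HasDerivAt.fun_sum fun j _ =>
        (hderiv r hr i j).mul_const (w j)).const_mul (star w i)).hasDerivWithinAt
    · exact (posSemidef_iff_dotProduct_mulVec.1 (hpos r hr)).2 w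
  exact hmono (Set.left_mem_Icc.2 hab) (Set.right_mem_Icc.2 hab) hab

variable [Finite ι] {A B : Matrix ι ι ℝ}

theorem posSemidef_map_pow {A : Matrix ι ι 𝕜} (hA : A.PosSemidef) (k : ℕ) :
    (A.map (· ^ k)).PosSemidef := by
  induction k with
  | zero =>
    convert posSemidef_vecMulVec_self_star (fun _ : ι => (1 : 𝕜)) using 1
    ext i j
    simp [vecMulVec_apply]
  | succ k ih =>
    simpa only [hadamard, map_apply, ← pow_succ, Matrix.map, of_apply] using ih.hadamard hA

theorem isCompletelyMonotonicOnIoi_rpow_neg {a : ℝ} (ha : 0 < a) :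
    IsCompletelyMonotonicOnIoi fun u => u ^ (-a) where
  contDiffOn u hu := (Real.contDiffAt_rpow_const_of_ne (Set.mem_Ioi.1 hu).ne').contDiffWithinAt
  sign k u hu := by
    rw [iteratedDeriv_eq_iterate, Real.iter_deriv_rpow_const, ← mul_assoc,
      ← ascPochhammer_eval_neg_eq_descPochhammer, neg_neg]
    exact mul_nonneg (ascPochhammer_pos k a ha).le (Real.rpow_nonneg hu.le _)

theorem IsCompletelyMonotonicOnIoi.posSemidef_map_const_sub {h : ℝ → ℝ} {d : ℝ}
    (hh : IsCompletelyMonotonicOnIoi h) (hd : 0 < d) (hA : A.PosSemidef)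
    (hAd : ∀ i j, A i j ∈ Set.Ico 0 d) : (A.map fun x => h (d - x)).PosSemidef := by
  have hsum : HasSum (fun k => ((-1) ^ k * iteratedDeriv k h d / k.factorial) • A.map (· ^ k))
      (A.map fun x => h (d - x)) :=
    hasSum_matrix_iff.2 fun i j => hh.hasSum (hAd i j).1 (hAd i j).2
  exact nonneg_iff_posSemidef.1 <| hsum.nonneg fun k => nonneg_iff_posSemidef.2 <|
    (posSemidef_map_pow hA k).smul <| div_nonneg (hh.sign k d hd) (by positivity)

theorem posSemidef_map_one_div_sqrt_one_sub_sq (hA : A.PosSemidef) (hA1 : ∀ i j, |A i j| < 1) :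
    (A.map fun x => 1 / √(1 - x ^ 2)).PosSemidef := by
  convert (isCompletelyMonotonicOnIoi_rpow_neg one_half_pos).posSemidef_map_const_sub one_pos
    (posSemidef_map_pow hA 2)
    (fun i j => ⟨sq_nonneg _, (sq_lt_one_iff_abs_lt_one _).2 (hA1 i j)⟩) using 1
  ext i j
  have := (sq_lt_one_iff_abs_lt_one _).2 (hA1 i j)
  simp only [map_apply]
  rw [Real.rpow_neg (by linarith), ← Real.sqrt_eq_rpow, one_div]

theorem posSemidef_map_arcsin (hA : A.PosSemidef) (hA1 : ∀ i j, |A i j| ≤ 1) :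
    (A.map Real.arcsin).PosSemidef := by
  have hlt : ∀ r ∈ Set.Ioo (0 : ℝ) 1, ∀ i j, |(r • A) i j| < 1 := fun r hr i j => by
    rw [Matrix.smul_apply, smul_eq_mul, abs_mul, abs_of_pos hr.1]
    exact mul_lt_one_of_nonneg_of_lt_one_left hr.1.le hr.2 (hA1 i j)
  have hherm : ∀ r : ℝ, ((r • A).map Real.arcsin).IsHermitian := fun r =>
    (hA.1.smul (IsSelfAdjoint.all r)).map Real.arcsin fun _ => rfl
  have hle := le_of_hasDerivAt_posSemidef (F := fun r => (r • A).map Real.arcsin)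
    (F' := fun r => ((r • A).map fun x => 1 / √(1 - x ^ 2)) ⊙ A) zero_le_one
    (hherm 0) (hherm 1) (by fun_prop) (fun r hr i j => ?_) fun r hr =>
      (posSemidef_map_one_div_sqrt_one_sub_sq (hA.smul hr.1.le) (hlt r hr)).hadamard hA
  · simpa [nonneg_iff_posSemidef] using hle
  · have habs := abs_lt.1 (hlt r hr i j)
    exact (Real.hasDerivAt_arcsin habs.1.ne' habs.2.ne).comp r (hasDerivAt_mul_const (A i j))

theorem tendsto_map_pow_one {ι : Type*} [DecidableEq ι] {C : Matrix ι ι ℝ}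
    (hdiag : ∀ i, C i i = 1) (hoff : ∀ i j, i ≠ j → |C i j| < 1) :
    Tendsto (fun k : ℕ => C.map (· ^ k)) atTop (𝓝 1) := by
  refine tendsto_matrix_iff.2 fun i j => ?_
  rcases eq_or_ne i j with rfl | hij
  · simp [hdiag]
  · simpa [hij] using tendsto_pow_atTop_nhds_zero_of_abs_lt_one (hoff i j hij)

namespace IsCompletelyMonotonic

variable {g : ℝ × ℝ → ℝ} {d e : ℝ}

theorem reflectedTaylorCoeff_smul_le_of_lt (hg : IsCompletelyMonotonic g) (hd : 0 < d) (he : 0 < e)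
    (hA : A.PosSemidef) (hAd : ∀ i j, A i j ∈ Set.Ico 0 d)
    (hB : B.PosSemidef) (hBe : ∀ i j, B i j ∈ Set.Ico 0 e) (p : ℕ × ℕ) :
    reflectedTaylorCoeff g d e p • (A.map (· ^ p.1) ⊙ B.map (· ^ p.2)) ≤
      of fun i j => g (d - A i j, e - B i j) := by
  have hsum : HasSum
      (fun p : ℕ × ℕ => reflectedTaylorCoeff g d e p • (A.map (· ^ p.1) ⊙ B.map (· ^ p.2)))
      (of fun i j => g (d - A i j, e - B i j)) :=
    hasSum_matrix_iff.2 fun i j =>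
      hg.hasSum_reflectedTaylorCoeff (hAd i j).1 (hAd i j).2 (hBe i j).1 (hBe i j).2
  exact le_hasSum hsum p fun q _ => nonneg_iff_posSemidef.2 <|
    ((posSemidef_map_pow hA q.1).hadamard (posSemidef_map_pow hB q.2)).smul
      (hg.reflectedTaylorCoeff_nonneg hd he q)

theorem reflectedTaylorCoeff_smul_le (hg : IsCompletelyMonotonic g) (hd : 0 < d) (he : 0 < e)
    (hA : A.PosSemidef) (hAd : ∀ i j, A i j ∈ Set.Icc 0 d)
    (hB : B.PosSemidef) (hBe : ∀ i j, B i j ∈ Set.Icc 0 e) (p : ℕ × ℕ) :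
    reflectedTaylorCoeff g d e p • (A.map (· ^ p.1) ⊙ B.map (· ^ p.2)) ≤
      of fun i j => g (d - A i j, e - B i j) := by
  have hunit : ∀ᶠ r : ℝ in 𝓝[<] 1, r ∈ Set.Ioo (0 : ℝ) 1 := Ioo_mem_nhdsLT one_pos
  have hscale : ∀ {r t c : ℝ}, r ∈ Set.Ioo (0 : ℝ) 1 → 0 < c → t ∈ Set.Icc 0 c →
      r * t ∈ Set.Ico 0 c := fun hr hc ht => ⟨mul_nonneg hr.1.le ht.1,
    (mul_le_mul_of_nonneg_left ht.2 hr.1.le).trans_lt (mul_lt_of_lt_one_left hc hr.2)⟩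
  have hleft : Tendsto (fun r : ℝ => reflectedTaylorCoeff g d e p •
      ((r • A).map (· ^ p.1) ⊙ (r • B).map (· ^ p.2))) (𝓝[<] 1)
      (𝓝 (reflectedTaylorCoeff g d e p • (A.map (· ^ p.1) ⊙ B.map (· ^ p.2)))) := by
    refine tendsto_matrix_iff.2 fun i j => ?_
    have hcont : Continuous fun r : ℝ =>
        reflectedTaylorCoeff g d e p * ((r * A i j) ^ p.1 * (r * B i j) ^ p.2) := by fun_prop
    simpa using (hcont.tendsto 1).mono_left nhdsWithin_le_nhds
  have hright : Tendsto (fun r : ℝ => of fun i j => g (d - (r • A) i j, e - (r • B) i j)) (𝓝[<] 1)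
      (𝓝 (of fun i j => g (d - A i j, e - B i j))) := by
    refine tendsto_matrix_iff.2 fun i j => ?_
    have hcont : Continuous fun r : ℝ => (d - r * A i j, e - r * B i j) := by fun_prop
    refine (hg.continuousOn (d - A i j, e - B i j)
      ⟨sub_nonneg.2 (hAd i j).2, sub_nonneg.2 (hBe i j).2⟩).tendsto.comp
      (tendsto_nhdsWithin_iff.2 ⟨?_, hunit.mono fun r hr =>
        ⟨sub_nonneg.2 (hscale hr hd (hAd i j)).2.le, sub_nonneg.2 (hscale hr he (hBe i j)).2.le⟩⟩)
    simpa using (hcont.tendsto 1).mono_left nhdsWithin_le_nhds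
  exact le_of_tendsto_of_tendsto hleft hright <| hunit.mono fun r hr =>
    hg.reflectedTaylorCoeff_smul_le_of_lt hd he
      (hA.smul hr.1.le) (fun i j => hscale hr hd (hAd i j))
      (hB.smul hr.1.le) (fun i j => hscale hr he (hBe i j)) p

theorem posSemidef_apply_const_sub (hg : IsCompletelyMonotonic g) (hd : 0 < d) (he : 0 < e)
    (hA : A.PosSemidef) (hAd : ∀ i j, A i j ∈ Set.Icc 0 d)
    (hB : B.PosSemidef) (hBe : ∀ i j, B i j ∈ Set.Icc 0 e) :
    (of fun i j => g (d - A i j, e - B i j)).PosSemidef :=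
  nonneg_iff_posSemidef.1 <| (nonneg_iff_posSemidef.2 <|
    ((posSemidef_map_pow hA 0).hadamard (posSemidef_map_pow hB 0)).smul
      (hg.reflectedTaylorCoeff_nonneg hd he (0, 0))).trans
    (hg.reflectedTaylorCoeff_smul_le hd he hA hAd hB hBe (0, 0))

theorem posDef_apply_const_sub (hg : IsCompletelyMonotonic g)
    (hadd : ¬ ∃ a b : ℝ → ℝ, ∀ u v : ℝ, 0 ≤ u → 0 ≤ v → g (u, v) = a u + b v)
    (hd : 0 < d) (he : 0 < e)
    (hA : A.PosSemidef) (hAd : ∀ i j, A i j ∈ Set.Icc 0 d)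
    (hB : B.PosSemidef) (hBe : ∀ i j, B i j ∈ Set.Icc 0 e)
    (hAB : ∀ i j, A i j = d ∧ B i j = e ↔ i = j) :
    (of fun i j => g (d - A i j, e - B i j)).PosDef := by
  classical
  set C : Matrix ι ι ℝ := of fun i j => A i j * B i j / (d * e) with hC
  have hpow : Tendsto (fun k : ℕ => C.map (· ^ (k + 1))) atTop (𝓝 1) := by
    refine (tendsto_map_pow_one (fun i => ?_) fun i j hij => ?_).comp (tendsto_add_atTop_nat 1)
    · obtain ⟨hAi, hBi⟩ := (hAB i i).2 rfl
      simp [hC, hAi, hBi, hd.ne', he.ne']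
    · rw [hC, of_apply, abs_of_nonneg (div_nonneg (mul_nonneg (hAd i j).1 (hBe i j).1)
        (by positivity)), div_lt_one (by positivity)]
      refine (mul_le_mul (hAd i j).2 (hBe i j).2 (hBe i j).1 hd.le).lt_of_ne fun heq => hij ?_
      have hBpos : 0 < B i j := (hBe i j).1.lt_of_ne' fun h0 =>
        (mul_pos hd he).ne (by rw [← heq, h0, mul_zero])
      exact (hAB i j).1
        ((mul_eq_mul_iff_eq_and_eq_of_pos' (hAd i j).2 (hBe i j).2 hd hBpos).1 heq)
  have hpsd := hg.posSemidef_apply_const_sub hd he hA hAd hB hBe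
  refine posDef_of_tendsto_of_smul_le .one hpow hpsd.1 fun k =>
    ⟨reflectedTaylorCoeff g d e (k + 1, k + 1) * (d * e) ^ (k + 1),
      mul_pos (hg.reflectedTaylorCoeff_pos hadd hd he k k) (by positivity), ?_⟩
  convert hg.reflectedTaylorCoeff_smul_le hd he hA hAd hB hBe (k + 1, k + 1) using 1
  ext i j
  simp only [hC, Matrix.smul_apply, map_apply, of_apply, hadamard_apply, smul_eq_mul, div_pow,
    mul_pow]
  field_simp

end IsCompletelyMonotonic

end LoewnerOrder

section Sphere

open Matrix

variable {E F ι : Type*} [NormedAddCommGroup E] [InnerProductSpace ℝ E] [NormedAddCommGroup F]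
  [InnerProductSpace ℝ F]

theorem pi_sub_arccos_mem_Icc (t : ℝ) : Real.pi - Real.arccos t ∈ Set.Icc 0 Real.pi :=
  ⟨sub_nonneg.2 (Real.arccos_le_pi t), sub_le_self _ (Real.arccos_nonneg t)⟩

theorem posSemidef_pi_sub_arccos_inner [Finite ι] (x : ι → Metric.sphere (0 : E) 1) :
    (of fun i j => Real.pi - Real.arccos (inner ℝ (x i : E) (x j : E))).PosSemidef := by
  have hgram := posSemidef_map_arcsin (posSemidef_gram ℝ fun i => (x i : E)) fun i j => by
    simpa using abs_real_inner_le_norm (x i : E) (x j)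
  convert hgram.add ((posSemidef_vecMulVec_self_star fun _ : ι => (1 : ℝ)).smul
    Real.pi_div_two_pos.le) using 1
  ext i j
  simp only [of_apply, Matrix.add_apply, map_apply, gram_apply, Matrix.smul_apply, vecMulVec_apply,
    star_trivial, smul_eq_mul, Real.arccos_eq_pi_div_two_sub_arcsin]
  ring

theorem arccos_inner_eq_zero_iff (x y : Metric.sphere (0 : E) 1) :
    Real.arccos (inner ℝ (x : E) (y : E)) = 0 ↔ x = y := by
  rw [Real.arccos_eq_zero, Subtype.ext_iff,
    ← inner_eq_one_iff_of_norm_eq_one (𝕜 := ℝ) (norm_eq_of_mem_sphere x) (norm_eq_of_mem_sphere y)]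
  refine ⟨fun h => le_antisymm ?_ h, fun h => h.ge⟩
  simpa using real_inner_le_norm (x : E) (y : E)

/-- The kernel on a product of two unit spheres whose value at a pair of points is `g` of the two
geodesic distances between their components. -/
noncomputable def geodesicKernel (g : ℝ × ℝ → ℝ)
    (p q : Metric.sphere (0 : E) 1 × Metric.sphere (0 : F) 1) : ℝ :=
  g (Real.arccos (inner ℝ (p.1 : E) (q.1 : E)), Real.arccos (inner ℝ (p.2 : F) (q.2 : F)))

theorem sum_mul_mul_eq_dotProduct_mulVec {R : Type*} [CommSemiring R] [Fintype ι]
    (K : Matrix ι ι R) (c : ι → R) : ∑ i, ∑ j, c i * c j * K i j = c ⬝ᵥ K *ᵥ c := by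
  simp only [dotProduct, mulVec, mul_sum]
  exact sum_congr rfl fun i _ => sum_congr rfl fun j _ => by ring

theorem isPosDefKernel_of_posSemidef {X : Type} {K : X → X → ℝ}
    (hK : ∀ (n : ℕ) (x : Fin n → X), (of fun i j => K (x i) (x j)).PosSemidef) :
    IsPosDefKernel K := fun n _ x _ c => by
  simpa only [star_trivial, ← sum_mul_mul_eq_dotProduct_mulVec, of_apply] using
    (posSemidef_iff_dotProduct_mulVec.1 (hK n x)).2 c

namespace IsCompletelyMonotonic

variable {g : ℝ × ℝ → ℝ}

theorem continuous_geodesicKernel (hg : IsCompletelyMonotonic g) :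
    Continuous (Function.uncurry (geodesicKernel (E := E) (F := F) g)) :=
  hg.continuousOn.comp_continuous
    (f := fun pq : (Metric.sphere (0 : E) 1 × Metric.sphere (0 : F) 1) ×
        (Metric.sphere (0 : E) 1 × Metric.sphere (0 : F) 1) =>
      (Real.arccos (inner ℝ (pq.1.1 : E) (pq.2.1 : E)),
        Real.arccos (inner ℝ (pq.1.2 : F) (pq.2.2 : F))))
    (by fun_prop) fun _ => ⟨Real.arccos_nonneg _, Real.arccos_nonneg _⟩

theorem posSemidef_geodesicKernel [Finite ι] (hg : IsCompletelyMonotonic g)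
    (x : ι → Metric.sphere (0 : E) 1 × Metric.sphere (0 : F) 1) :
    (of fun i j => geodesicKernel g (x i) (x j)).PosSemidef := by
  simpa only [of_apply, sub_sub_cancel] using!
    hg.posSemidef_apply_const_sub Real.pi_pos Real.pi_pos
    (posSemidef_pi_sub_arccos_inner fun i => (x i).1) (fun _ _ => pi_sub_arccos_mem_Icc _)
    (posSemidef_pi_sub_arccos_inner fun i => (x i).2) (fun _ _ => pi_sub_arccos_mem_Icc _)

theorem posDef_geodesicKernel [Finite ι] (hg : IsCompletelyMonotonic g)
    (hadd : ¬ ∃ a b : ℝ → ℝ, ∀ u v : ℝ, 0 ≤ u → 0 ≤ v → g (u, v) = a u + b v)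
    {x : ι → Metric.sphere (0 : E) 1 × Metric.sphere (0 : F) 1} (hx : Function.Injective x) :
    (of fun i j => geodesicKernel g (x i) (x j)).PosDef := by
  simpa only [of_apply, sub_sub_cancel] using!
    hg.posDef_apply_const_sub hadd Real.pi_pos Real.pi_pos
    (posSemidef_pi_sub_arccos_inner fun i => (x i).1) (fun _ _ => pi_sub_arccos_mem_Icc _)
    (posSemidef_pi_sub_arccos_inner fun i => (x i).2) (fun _ _ => pi_sub_arccos_mem_Icc _)
    fun i j => by
      simp only [of_apply, sub_eq_self, arccos_inner_eq_zero_iff, ← Prod.ext_iff, hx.eq_iff]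

end IsCompletelyMonotonic

end Sphere

theorem mainTheorem4_general {E F : Type} [NormedAddCommGroup E] [InnerProductSpace ℝ E]
    [NormedAddCommGroup F] [InnerProductSpace ℝ F] {g : ℝ × ℝ → ℝ} (hg : IsCompletelyMonotonic g) :
    Continuous (Function.uncurry (geodesicKernel (E := E) (F := F) g)) ∧
    IsPosDefKernel (geodesicKernel (E := E) (F := F) g) ∧
    ((¬ ∃ a b : ℝ → ℝ, ∀ u v : ℝ, 0 ≤ u → 0 ≤ v → g (u, v) = a u + b v) →
      ∀ n : ℕ, IsStrictlyPosDefOfOrder n (geodesicKernel (E := E) (F := F) g)) := by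
  have hpd : IsPosDefKernel (geodesicKernel (E := E) (F := F) g) :=
    isPosDefKernel_of_posSemidef fun _ => hg.posSemidef_geodesicKernel
  refine ⟨hg.continuous_geodesicKernel, hpd, fun hadd n => ⟨hpd, fun x hx c hc => ?_⟩⟩
  exact (sum_mul_mul_eq_dotProduct_mulVec _ c).trans_gt
    ((hg.posDef_geodesicKernel hadd hx).dotProduct_mulVec_pos hc)

theorem mainTheorem4 (m M : ℕ∞) (hm : 1 ≤ m) (hM : 1 ≤ M)
    (g : ℝ × ℝ → ℝ) (hg : IsCompletelyMonotonic g) :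
    IsPartOfPosDef m M (fun t s => g (Real.arccos t, Real.arccos s)) ∧
    ((¬ ∃ a b : ℝ → ℝ, ∀ u v : ℝ, 0 ≤ u → 0 ≤ v → g (u, v) = a u + b v) →
      IsPartOfStrictlyPosDef m M (fun t s => g (Real.arccos t, Real.arccos s))) := by
  obtain ⟨hcont, hpd, hspd⟩ := mainTheorem4_general (E := Ambient m) (F := Ambient M) hg
  exact ⟨⟨_, fun _ _ _ _ => rfl, hcont, hpd⟩,
    fun hadd => ⟨_, fun _ _ _ _ => rfl, hcont, fun n _ => hspd hadd n⟩⟩
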